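/- **Theorem.** A deterministic, work-conserving first-come-first-served scheduler serves one packet per time slot and is shared by an encoder user $U_e$ and a decoder user $U_d$. In each slot each user sends one packet or none; of two packets arriving in the same slot the packet of $U_d$ is queued first; a fixed number $b\ge 0$ of other packets is in the queue at time zero. A code of block length $N\ge 1$ consists of $M\ge 1$ equiprobable binary codewords of length $N$ (bit $i$ of the codeword says whether $U_e$ sends a packet in slot $i$), a binary probe stream of length $N$ sent by $U_d$, fixed in advance or drawn at random independently of the message, and a decoding rule that guesses the message from the probe stream and from the slots in which the probe packets are served. A message is received when the $N$ slots are over and the last probe packet has been served. An $(n,M,\epsilon)$-code is a code with $M$ codewords whose messages take on average $n$ slots to be received, whose average error probability is at most $\epsilon$, and which is stable: the average packet rates (expected number of packets divided by $N$) of the two users satisfy $r_e+r_d<1$. The capacity $C$ (in bits per time slot) is the supremum of the numbers $R$ such that for every $\delta>0$ there are $(n,M,\epsilon_n)$-codes with $\frac{\log_2 M}{n}>R-\delta$ and $\epsilon_n\to 0$ as $n\to\infty$. For $\gamma\in[0,1]$ and an integer $k\ge 1$ let $$\tilde H\Big(\gamma,\frac1k\Big)=\frac1k\max\{H(X): X\in\{0,1,\dots,k\},\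 \mathbb E[X]=k\gamma\},$$ where $H$ is the Shannon entropy in bits. Then, for every $b$, $$C=\max_{\alpha,\gamma_1,\gamma_2}\ \alpha\,\tilde H(\gamma_1,1)+(1-\alpha)\,\tilde H\Big(\gamma_2,\frac12\Big),$$ where the maximum is over all $0\le\alpha\le1$ and $0\le\gamma_1,\gamma_2\le\frac12$ with $$\alpha(\gamma_1+1)+(1-\alpha)\Big(\gamma_2+\frac12\Big)=1.$$ Numerically $C\approx 0.8114$ (that is, $|C-0.8114|\le 5\cdot10^{-5}$), and the maximum is attained at a point with $\alpha\approx0.177$, $\gamma_1\approx0.43$, $\gamma_2\approx0.407$, each correct to the digits given ($|\alpha-0.177|\le 5\cdot 10^{-4}$, $|\gamma_1-0.43|\le 5\cdot10^{-3}$, $|\gamma_2-0.407|\le5\cdot10^{-4}$). -/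

import Mathlib

/-!
A covert timing channel between two users of a deterministic work-conserving FCFS scheduler that
serves one packet per time slot.
-/

noncomputable section

namespace CovertQueue

open Filter Topology

/-! ### The scheduler -/

/-- The packets in the buffer: those of the encoder user, those of the decoder user (the probe
stream), and those that were in the buffer before the transmission starts. -/
inductive Packet where
  | enc
  | probe
  | old

/-- The packets arriving in one slot, in the order in which they join the queue: in the case of
simultaneous arrivals the decoder's packet has priority. -/
def arrivals (d e : Bool) : List Packet :=
  (if d then [Packet.probe] else []) ++ (if e then [Packet.enc] else [])

/-- Content of the FCFS queue in slot `t`, after the arrivals of slot `t` and before the service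
of slot `t`, when `b` packets are buffered at time zero, the decoder's arrival stream is `d` and
the encoder's arrival stream is `e`. In each slot the packet at the head of the line (if there
is one) is served and leaves. -/
def queue (b : ℕ) (d e : ℕ → Bool) : ℕ → List Packet
  | 0 => List.replicate b Packet.old ++ arrivals (d 0) (e 0)
  | t + 1 => (queue b d e t).tail ++ arrivals (d (t + 1)) (e (t + 1))

/-- The output stream seen by the decoder user: whether a packet of the probe stream is served
in slot `t`. -/
def probeOutput (b : ℕ) (d e : ℕ → Bool) (t : ℕ) : Bool :=
  match (queue b d e t).head? with
  | some Packet.probe => true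
  | _ => false

/-- A binary word of length `N` as an arrival stream: one slot per bit, idle afterwards. -/
def stream {N : ℕ} (x : Fin N → Bool) (t : ℕ) : Bool :=
  if h : t < N then x ⟨t, h⟩ else false

/-- Number of packets of a binary word. -/
def weight {N : ℕ} (x : Fin N → Bool) : ℕ := ∑ i, (x i).toNat

/-- Number of slots used until a message is received: all `N` slots of the block are over and the
last probe packet has left the scheduler. -/
def receptionTime (b : ℕ) {N : ℕ} (d e : Fin N → Bool) : ℕ :=
  sInf {T : ℕ | N ≤ T ∧ ∀ t, T ≤ t → probeOutput b (stream d) (stream e) t = false}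

/-- The set whose infimum is the reception time is never empty. -/
theorem receptionTime_nonempty (b : ℕ) {N : ℕ} (d e : Fin N → Bool) :
    {T : ℕ | N ≤ T ∧ ∀ t, T ≤ t →
      probeOutput b (stream d) (stream e) t = false}.Nonempty := by
  have key : ∀ j, (queue b (stream d) (stream e) (N + j)).length ≤
      (queue b (stream d) (stream e) N).length - j := by
    intro j
    induction j with
    | zero => simp
    | succ j ih =>
      have h1 : ¬ (N + j + 1 < N) := by omega
      have h2 : queue b (stream d) (stream e) (N + (j + 1)) =
          (queue b (stream d) (stream e) (N + j)).tail := by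
        rw [← Nat.add_assoc]
        simp [queue, stream, arrivals, h1]
      rw [h2, List.length_tail]
      omega
  refine ⟨N + (queue b (stream d) (stream e) N).length, by omega, fun t ht => ?_⟩
  obtain ⟨j, rfl⟩ : ∃ j, t = N + j := ⟨t - N, by omega⟩
  have h := key j
  have h0 : (queue b (stream d) (stream e) (N + j)).length = 0 := by omega
  simp [probeOutput, List.length_eq_zero_iff.mp h0]

/-! ### Codes, rate, capacity -/

/-- A code: a codebook of `M` binary codewords of length `N`, a probe stream of length `N` drawn
independently of the message (a probe stream fixed in advance is a point mass), and a decoding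
rule, which sees the probe stream and the output stream of the decoder user. -/
structure Code where
  N : ℕ
  N_pos : 0 < N
  M : ℕ
  M_pos : 0 < M
  codeword : Fin M → Fin N → Bool
  probeLaw : (Fin N → Bool) → ℝ
  probeLaw_mem : probeLaw ∈ stdSimplex ℝ (Fin N → Bool)
  decode : (Fin N → Bool) → (ℕ → Bool) → Fin M

/-- Expectation of `f` over the probe stream and the equiprobable message. -/
def Code.mean (c : Code) (f : (Fin c.N → Bool) → Fin c.M → ℝ) : ℝ :=
  ∑ d, c.probeLaw d * ((1 / (c.M : ℝ)) * ∑ w, f d w)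

open Classical in
/-- The average error probability. -/
def Code.errorProb (c : Code) (b : ℕ) : ℝ :=
  c.mean fun d w =>
    if c.decode d (probeOutput b (stream d) (stream (c.codeword w))) = w then 0 else 1

/-- The average number of slots until the message is received. -/
def Code.avgTime (c : Code) (b : ℕ) : ℝ :=
  c.mean fun d w => (receptionTime b d (c.codeword w) : ℝ)

/-- The average packet rate of the encoder user. -/
def Code.encRate (c : Code) : ℝ := c.mean fun _ w => (weight (c.codeword w) : ℝ) / c.N

/-- The average packet rate of the decoder user. -/
def Code.probeRate (c : Code) : ℝ := c.mean fun d _ => (weight d : ℝ) / c.N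

/-- `c` is an `(n, M, ε)`-code over the scheduler with `b` initially buffered packets: `M`
equiprobable codewords, messages take on average `n` slots to be received, the error probability
is at most `ε`, and the queue is stable, i.e. the packet rates add up to less than the service
rate `1`. -/
structure Code.Is (c : Code) (b : ℕ) (n : ℝ) (M : ℕ) (ε : ℝ) : Prop where
  size : c.M = M
  time : c.avgTime b = n
  error : c.errorProb b ≤ ε
  stable : c.encRate + c.probeRate < 1

/-- The rate `R` (in bits per slot) is achievable: for every `δ > 0` there are
`(n, M, εₙ)`-codes with `log₂ M / n > R - δ` and `εₙ → 0` as `n → ∞`. -/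
def Achievable (b : ℕ) (R : ℝ) : Prop :=
  ∀ δ : ℝ, 0 < δ → ∃ (n : ℕ → ℝ) (M : ℕ → ℕ) (ε : ℕ → ℝ),
    (∀ k, ∃ c : Code, c.Is b (n k) (M k) (ε k)) ∧
    (∀ k, R - δ < Real.logb 2 (M k) / n k) ∧
    Tendsto n atTop atTop ∧ Tendsto ε atTop (𝓝 0)

/-- `C` is the capacity: the supremum of the achievable rates. -/
def IsCapacity (b : ℕ) (C : ℝ) : Prop := IsLUB {R : ℝ | Achievable b R} C

/-! ### The maximum entropy function -/

/-- Shannon entropy in bits. -/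
def entropy {k : ℕ} (q : Fin (k + 1) → ℝ) : ℝ := (∑ i, Real.negMulLog (q i)) / Real.log 2

/-- The entropies of the distributions on `{0, …, k}` with mean `k γ`. -/
def entropySet (γ : ℝ) (k : ℕ) : Set ℝ :=
  entropy '' {q | q ∈ stdSimplex ℝ (Fin (k + 1)) ∧ ∑ i : Fin (k + 1), ((i : ℕ) : ℝ) * q i = k * γ}

/-- `Htilde γ k` is `H̃(γ, 1/k)`: the maximum entropy, divided by `k`, of a random variable on
`{0, …, k}` with mean `k γ`. -/
def Htilde (γ : ℝ) (k : ℕ) : ℝ := (1 / (k : ℝ)) * sSup (entropySet γ k)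

/-- The supremum in the definition of `Htilde` is a maximum. -/
theorem isGreatest_entropySet {γ : ℝ} {k : ℕ} (h0 : 0 ≤ γ) (h1 : γ ≤ 1) :
    IsGreatest (entropySet γ k) (sSup (entropySet γ k)) := by
  have hcont : Continuous (entropy (k := k)) := by
    unfold entropy
    exact (continuous_finsetSum _ fun i _ =>
      Real.continuous_negMulLog.comp (continuous_apply i)).div_const _
  have hclosed : IsClosed {q : Fin (k + 1) → ℝ | ∑ i : Fin (k + 1), ((i : ℕ) : ℝ) * q i = k * γ} :=
    isClosed_eq (by fun_prop) continuous_const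
  have hcomp : IsCompact (entropySet γ k) :=
    ((isCompact_stdSimplex ℝ (Fin (k + 1))).inter_right hclosed).image hcont
  have hne : (entropySet γ k).Nonempty := by
    have hmem : ∀ i : Fin (k + 1), (Pi.single i (1 : ℝ) : Fin (k + 1) → ℝ) ∈
        stdSimplex ℝ (Fin (k + 1)) := fun i => single_mem_stdSimplex ℝ i
    refine Set.Nonempty.image _ ⟨(1 - γ) • Pi.single 0 1 + γ • Pi.single (Fin.last k) 1,
      convex_stdSimplex ℝ _ (hmem _) (hmem _) (by linarith) h0 (by ring), ?_⟩
    simp [mul_add, Finset.sum_add_distrib, Pi.single_apply]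
  exact hcomp.isGreatest_sSup hne

/-! ### The optimization problem -/

/-- Feasible triples `(α, γ₁, γ₂)`. -/
structure Feasible (α γ₁ γ₂ : ℝ) : Prop where
  α_mem : α ∈ Set.Icc (0 : ℝ) 1
  γ₁_mem : γ₁ ∈ Set.Icc (0 : ℝ) (1 / 2)
  γ₂_mem : γ₂ ∈ Set.Icc (0 : ℝ) (1 / 2)
  rate_eq : α * (γ₁ + 1) + (1 - α) * (γ₂ + 1 / 2) = 1

/-- The objective `α H̃(γ₁, 1) + (1 - α) H̃(γ₂, 1/2)`. -/
def objective (α γ₁ γ₂ : ℝ) : ℝ := α * Htilde γ₁ 1 + (1 - α) * Htilde γ₂ 2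

end CovertQueue

end

/-!
Let `β = base` be the root of `x ^ 3 + x ^ 2 = 1`, and give a block of `k` slots with one probe
packet and `j` encoder packets the weight `β ^ (k + 1 + j)`. For every `k` the sum of the weights
over `0 ≤ j ≤ k` is at most `1`, with equality exactly for `k = 1` and `k = 2`.

*Converse.* The output stream is determined by the numbers of encoder packets between successive
probe packets, so the weights `β ^ (slots + packets)` of codewords with different outputs satisfy a
Kraft inequality. A code with `M` messages therefore needs about `log M / (-log β)` slots and
packets, and stability allows at most one packet per slot.

*Optimization problem.* The same weights in Gibbs' inequality bound `H̃`, and for `k = 1, 2` they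
are themselves maximizing laws. As the total packet rate at a feasible point is exactly one, the
bounds add up to `-2 log₂ β`.

*Achievability.* Among the vectors of `A` loads of blocks of length `k = 1` or `k = 2`, whose
weights add up to `1`, some fixed total load `s` has weight at least `1 / (k A + 1)`; after
complementation, `2 s ≤ k A`. Blocks of the two lengths, combined so that packets and slots
balance, follow a prelude that fills the queue. The server then never idles, so that the
departure of a probe packet reveals the number of encoder packets before it, and the load vectors
can be decoded without error.
-/

noncomputable section

namespace CovertQueue

open Filter Topology

/-! ### Exponential weights -/

theorem exists_base :
    ∃ x : ℝ, x ^ 3 + x ^ 2 = 1 ∧ x ∈ Set.Ioo (0.7548776 : ℝ) 0.7548777 := by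
  have hcont : ContinuousOn (fun x : ℝ => x ^ 3 + x ^ 2) (Set.Icc 0.7548776 0.7548777) := by
    fun_prop
  obtain ⟨x, hx, h⟩ := intermediate_value_Ioo (by norm_num) hcont
    (show (1 : ℝ) ∈ Set.Ioo _ _ by constructor <;> norm_num)
  exact ⟨x, h, hx⟩

/-- The real root of `x ^ 3 + x ^ 2 = 1`, that is, the inverse of the plastic ratio: the weight of
one slot or one packet in the exponential weights that balance blocks of length one and two. -/
def base : ℝ := exists_base.choose

theorem base_eq : base ^ 3 + base ^ 2 = 1 := exists_base.choose_spec.1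

theorem lt_base : 0.7548776 < base := exists_base.choose_spec.2.1

theorem base_lt : base < 0.7548777 := exists_base.choose_spec.2.2

theorem base_pos : 0 < base := lt_trans (by norm_num) lt_base

theorem base_lt_one : base < 1 := base_lt.trans (by norm_num)

/-- The price of one slot or one packet, in nats. -/
def price : ℝ := -Real.log base

theorem price_pos : 0 < price := neg_pos.2 (Real.log_neg base_pos base_lt_one)

theorem log_base_pow (n : ℕ) : Real.log (base ^ n) = -(price * n) := by
  rw [Real.log_pow, price]; ring

/-- The closed form of the capacity, in bits per slot: a code pays `price` for each slot and for
each packet, and by stability there is at most one packet per slot. -/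
def capacity : ℝ := 2 * price / Real.log 2

/-- The weight of a block of `k` slots with one probe packet and `j` encoder packets: one factor
`base` for each slot and each packet. -/
def blockWeight (k j : ℕ) : ℝ := base ^ (k + 1 + j)

theorem blockWeight_pos (k j : ℕ) : 0 < blockWeight k j := pow_pos base_pos _

theorem log_blockWeight (k j : ℕ) : Real.log (blockWeight k j) = -(price * (k + 1 + j)) := by
  rw [blockWeight, log_base_pow]; push_cast; rfl

theorem one_sub_base_mul_one_sub_sum_blockWeight (k : ℕ) :
    (1 - base) * (1 - ∑ j ∈ Finset.range (k + 1), blockWeight k j) =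
      (base ^ 2 - base ^ (k + 1)) * (base ^ 3 - base ^ (k + 1)) := by
  have hgeom := mul_neg_geom_sum base (k + 1)
  simp only [blockWeight, pow_add base (k + 1), ← Finset.mul_sum]
  linear_combination
    -base ^ (k + 1) * hgeom + (base ^ (k + 1) - (base ^ 2 - base + 1)) * base_eq

-- No power of `base` lies strictly between `base ^ 3` and `base ^ 2`, so the two factors of the
-- preceding identity have the same sign; they vanish exactly at the block lengths `1` and `2`.
theorem sum_blockWeight_le_one (k : ℕ) : ∑ j ∈ Finset.range (k + 1), blockWeight k j ≤ 1 := by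
  have hfactors : 0 ≤ (base ^ 2 - base ^ (k + 1)) * (base ^ 3 - base ^ (k + 1)) := by
    have hanti : ∀ {m n : ℕ}, m ≤ n → base ^ n ≤ base ^ m := fun h =>
      pow_le_pow_of_le_one base_pos.le base_lt_one.le h
    rcases le_or_gt k 1 with hk | hk
    · exact mul_nonneg_of_nonpos_of_nonpos (sub_nonpos.2 (hanti (by lia)))
        (sub_nonpos.2 (hanti (by lia)))
    · exact mul_nonneg (sub_nonneg.2 (hanti (by lia))) (sub_nonneg.2 (hanti (by lia)))
  rw [← one_sub_base_mul_one_sub_sum_blockWeight] at hfactors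
  exact sub_nonneg.1 (nonneg_of_mul_nonneg_right hfactors (sub_pos.2 base_lt_one))

theorem sum_blockWeight_one : ∑ j ∈ Finset.range (1 + 1), blockWeight 1 j = 1 := by
  simp only [blockWeight, Finset.sum_range_succ, Finset.sum_range_zero]
  linear_combination base_eq

theorem sum_blockWeight_two : ∑ j ∈ Finset.range (2 + 1), blockWeight 2 j = 1 := by
  simp only [blockWeight, Finset.sum_range_succ, Finset.sum_range_zero]
  linear_combination (base ^ 2 + 1) * base_eq

set_option exponentiation.threshold 400 in
theorem abs_capacity_sub_le : |capacity - 0.8114| ≤ 0.00005 := by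
  have hlog2 : 0 < Real.log 2 := Real.log_pos one_lt_two
  -- `2 * 157 / 387` and `2 * 71 / 175` separate `capacity` from the two bounds.
  have hlower : base ^ 387 ≤ (2 ^ 157)⁻¹ :=
    (pow_le_pow_left₀ base_pos.le base_lt.le 387).trans (by norm_num)
  have hupper : (2 ^ 71)⁻¹ ≤ base ^ 175 :=
    le_trans (by norm_num) (pow_le_pow_left₀ (by norm_num) lt_base.le 175)
  replace hlower := Real.log_le_log (pow_pos base_pos _) hlower
  replace hupper := Real.log_le_log (by positivity) hupper
  rw [log_base_pow, Real.log_inv, Real.log_pow] at hlower hupper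
  push_cast at hlower hupper
  have hcapacity : capacity * Real.log 2 = 2 * price := div_mul_cancel₀ _ hlog2.ne'
  rw [abs_le]
  constructor <;> nlinarith

/-! ### Lindley recursion for the scheduler -/

/-- The number of packets of an arrival stream before slot `t`. -/
def count (f : ℕ → Bool) (t : ℕ) : ℕ := ∑ i ∈ Finset.range t, (f i).toNat

theorem count_succ (f : ℕ → Bool) (t : ℕ) : count f (t + 1) = count f t + (f t).toNat :=
  Finset.sum_range_succ _ _

theorem count_mono (f : ℕ → Bool) : Monotone (count f) :=
  monotone_nat_of_le_succ fun t => by rw [count_succ]; lia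

theorem count_lt_count {f : ℕ → Bool} {s t : ℕ} (hs : f s = true) (h : s < t) :
    count f s < count f t :=
  lt_of_lt_of_le (by simp [count_succ, hs]) (count_mono f (Nat.succ_le_of_lt h))

/-- The slot in which a probe packet that arrives in slot `t` is served, by Lindley's recursion;
probe packets have priority, so the encoder packet of slot `t` itself does not matter. -/
def departure (b : ℕ) (d e : ℕ → Bool) : ℕ → ℕ
  | 0 => b
  | t + 1 => max (t + 1) (departure b d e t + (d t).toNat + (e t).toNat)

section Departure

variable (b : ℕ) (d e : ℕ → Bool)

theorem le_departure (t : ℕ) : t ≤ departure b d e t := by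
  cases t with
  | zero => exact Nat.zero_le _
  | succ t => exact le_max_left _ _

theorem departure_mono : Monotone (departure b d e) :=
  monotone_nat_of_le_succ fun t => le_max_of_le_right (by lia)

variable {d} in
theorem departure_lt_departure {s t : ℕ} (hs : d s = true) (h : s < t) :
    departure b d e s < departure b d e t := by
  refine lt_of_lt_of_le ?_ (departure_mono b d e (Nat.succ_le_of_lt h))
  simp only [departure, hs, Bool.toNat_true]
  lia

theorem length_queue_add (t : ℕ) :
    (queue b d e t).length + t = departure b d e t + (d t).toNat + (e t).toNat := by
  have length_arrivals (x y : Bool) : (arrivals x y).length = x.toNat + y.toNat := by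
    cases x <;> cases y <;> rfl
  induction t with
  | zero => simp [queue, departure, length_arrivals, add_assoc]
  | succ t ih =>
    rw [queue, List.length_append, List.length_tail, length_arrivals, departure]
    lia

theorem getElem?_append_arrivals (Q : List Packet) (x y : Bool) (i : ℕ) :
    (Q ++ arrivals x y)[i]? = some Packet.probe ↔
      Q[i]? = some Packet.probe ∨ x = true ∧ i = Q.length := by
  rcases lt_or_ge i Q.length with h | h
  · simp [List.getElem?_append_left h, h.ne]
  · obtain ⟨j, rfl⟩ := Nat.exists_eq_add_of_le h
    rw [List.getElem?_append_right h, List.getElem?_eq_none h]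
    rcases j with _ | _ | j <;> cases x <;> cases y <;> simp [arrivals]

theorem getElem?_queue (t i : ℕ) :
    (queue b d e t)[i]? = some Packet.probe ↔
      ∃ s ≤ t, d s = true ∧ departure b d e s = t + i := by
  induction t generalizing i with
  | zero =>
    rw [queue, getElem?_append_arrivals, List.length_replicate, List.getElem?_replicate]
    simp only [Nat.le_zero, exists_eq_left, departure, Nat.zero_add, eq_comm (a := b)]
    split_ifs with h
    · simp [h.ne]
    · simp
  | succ t ih =>
    have hlength : (queue b d e t).tail.length + (t + 1) = departure b d e (t + 1) := by
      have := length_queue_add b d e t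
      rw [List.length_tail, departure]
      lia
    rw [queue, getElem?_append_arrivals, List.getElem?_tail, ih]
    constructor
    · rintro (⟨s, hst, hd, hs⟩ | ⟨hd, hi⟩)
      · exact ⟨s, by lia, hd, by lia⟩
      · exact ⟨t + 1, le_rfl, hd, by lia⟩
    · rintro ⟨s, hst, hd, hs⟩
      rcases Nat.le_succ_iff.1 hst with hst | rfl
      · exact .inl ⟨s, hst, hd, by lia⟩
      · exact .inr ⟨hd, by lia⟩

theorem probeOutput_eq_true_iff (t : ℕ) :
    probeOutput b d e t = true ↔ ∃ s, d s = true ∧ departure b d e s = t := by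
  have hhead : probeOutput b d e t = true ↔ (queue b d e t)[0]? = some Packet.probe := by
    rw [probeOutput, List.head?_eq_getElem?]
    rcases (queue b d e t)[0]? with _ | (_ | _ | _) <;> simp
  rw [hhead, getElem?_queue]
  exact exists_congr fun s => ⟨fun h => h.2, fun h => ⟨h.2 ▸ le_departure b d e s, h⟩⟩

variable {b d e}

theorem probeOutput_eq_iff {e' : ℕ → Bool} :
    probeOutput b d e = probeOutput b d e' ↔
      ∀ s, d s = true → departure b d e s = departure b d e' s := by
  have hmono (f : ℕ → Bool) : StrictMono fun s : {s // d s = true} => departure b d f s :=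
    fun s t h => departure_lt_departure b f s.2 h
  have hrange (f : ℕ → Bool) : Set.range (fun s : {s // d s = true} => departure b d f s) =
      {t | probeOutput b d f t = true} := by
    ext t
    simp [probeOutput_eq_true_iff]
  calc probeOutput b d e = probeOutput b d e'
      ↔ {t | probeOutput b d e t = true} = {t | probeOutput b d e' t = true} := by
        rw [funext_iff, Set.ext_iff]
        exact forall_congr' fun t => Bool.eq_iff_iff
    _ ↔ _ := by
        rw [← hrange, ← hrange, (hmono e).range_inj (hmono e'), funext_iff, Subtype.forall]

theorem probeOutput_congr {e' : ℕ → Bool} (h : ∀ s, d s = true → count e s = count e' s) :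
    probeOutput b d e = probeOutput b d e' := by
  -- Between two probes the departures follow the same reflected walk, with a common offset `c`.
  have hoffset (t : ℕ) : ∃ c : ℤ, (departure b d e t : ℤ) = max ↑t (count e t + c) ∧
      (departure b d e' t : ℤ) = max ↑t (count e' t + c) := by
    induction t with
    | zero => exact ⟨b, by simp [departure, count], by simp [departure, count]⟩
    | succ t ih =>
      obtain ⟨c, hc, hc'⟩ := ih
      simp only [departure, count_succ]
      cases hd : d t with
      | false => exact ⟨c, by grind [Bool.toNat_le], by grind [Bool.toNat_le]⟩
      | true =>
        have := h t hd
        exact ⟨departure b d e t - count e t + 1, by grind, by grind⟩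
  refine probeOutput_eq_iff.2 fun s hs => ?_
  obtain ⟨c, hc, hc'⟩ := hoffset s
  rw [h s hs] at hc
  exact_mod_cast hc.trans hc'.symm

theorem departure_eq_of_busy {t : ℕ} (hbusy : ∀ s ≤ t, s ≤ b + count d s + count e s) :
    departure b d e t = b + count d t + count e t := by
  induction t with
  | zero => rfl
  | succ t ih =>
    have := hbusy (t + 1) le_rfl
    have := ih fun s hs => hbusy s (by lia)
    simp only [departure, count_succ] at *
    lia

end Departure

section Stream

variable {N : ℕ}

theorem stream_of_lt (x : Fin N → Bool) {t : ℕ} (h : t < N) : stream x t = x ⟨t, h⟩ :=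
  dif_pos h

theorem lt_of_stream {x : Fin N → Bool} {t : ℕ} (h : stream x t = true) : t < N := by
  by_contra hn
  simp [stream, hn] at h

theorem count_stream (x : Fin N → Bool) : count (stream x) N = weight x := by
  rw [count, weight, Finset.sum_range]
  exact Finset.sum_congr rfl fun i _ => by rw [stream_of_lt x i.2]

theorem le_receptionTime (b : ℕ) (d e : Fin N → Bool) : N ≤ receptionTime b d e :=
  (Nat.sInf_mem (receptionTime_nonempty b d e)).1

end Stream

/-! ### Kraft inequality -/

theorem sum_prod_le_prod_sum {ι κ α : Type*} [Fintype κ] {S : Finset ι} {x : ι → κ → α}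
    {t : κ → Finset α} {f : κ → α → ℝ} (hf : ∀ k a, 0 ≤ f k a)
    (hx : ∀ i ∈ S, ∀ k, x i k ∈ t k) (hinj : Set.InjOn x S) :
    ∑ i ∈ S, ∏ k, f k (x i k) ≤ ∏ k, ∑ a ∈ t k, f k a := by
  classical
  calc ∑ i ∈ S, ∏ k, f k (x i k) = ∑ y ∈ S.image x, ∏ k, f k (y k) := by
        rw [Finset.sum_image hinj]
    _ ≤ ∑ y ∈ Fintype.piFinset t, ∏ k, f k (y k) :=
        Finset.sum_le_sum_of_subset_of_nonneg
          (Finset.image_subset_iff.2 fun i hi => Fintype.mem_piFinset.2 (hx i hi))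
          fun y _ _ => Finset.prod_nonneg fun k _ => hf k (y k)
    _ = ∏ k, ∑ a ∈ t k, f k a := (Finset.prod_univ_sum t f).symm

/-- The slots before slot `N` that lie between the `r`-th and the `(r + 1)`-st probe packet, the
slot of the former included; block `0` precedes the first probe packet. -/
def block (d : ℕ → Bool) (N r : ℕ) : Finset ℕ := {i ∈ Finset.range N | count d (i + 1) = r}

/-- The number of encoder packets in the `r`-th block. -/
def blockLoad (d : ℕ → Bool) (N : ℕ) (e : ℕ → Bool) (r : ℕ) : ℕ := ∑ i ∈ block d N r, (e i).toNat

theorem blockLoad_le_card (d : ℕ → Bool) (N : ℕ) (e : ℕ → Bool) (r : ℕ) :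
    blockLoad d N e r ≤ (block d N r).card :=
  (Finset.sum_le_card_nsmul _ _ 1 fun i _ => Bool.toNat_le (e i)).trans_eq (by simp)

theorem sum_block_le {d : ℕ → Bool} {N R : ℕ} (f : ℕ → ℕ) :
    ∑ r ∈ Finset.range R, ∑ i ∈ block d N r, f i ≤ ∑ i ∈ Finset.range N, f i := by
  simp only [block, Finset.sum_fiberwise_eq_sum_filter]
  exact Finset.sum_le_sum_of_subset (Finset.filter_subset _ _)

theorem sum_blockLoad_eq_count {d : ℕ → Bool} {N s : ℕ} (hd : d s = true) (hs : s < N)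
    (e : ℕ → Bool) : ∑ r ∈ Finset.range (count d s + 1), blockLoad d N e r = count e s := by
  have hslots : {i ∈ Finset.range N | count d (i + 1) ∈ Finset.range (count d s + 1)} =
      Finset.range s := by
    ext i
    simp only [Finset.mem_filter, Finset.mem_range]
    refine ⟨fun hi => ?_, fun h => ⟨h.trans hs, Nat.lt_succ_of_le (count_mono d h)⟩⟩
    by_contra! hsi
    exact (Nat.lt_succ_iff.1 hi.2).not_gt (count_lt_count hd (Nat.lt_succ_of_le hsi))
  simp only [blockLoad, block, Finset.sum_fiberwise_eq_sum_filter, hslots]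
  rfl

section Kraft

variable {b N : ℕ} (d : Fin N → Bool)

theorem probeOutput_eq_of_blockLoad_eq {e e' : ℕ → Bool}
    (h : ∀ r : Fin (weight d), blockLoad (stream d) N e r = blockLoad (stream d) N e' r) :
    probeOutput b (stream d) e = probeOutput b (stream d) e' := by
  refine probeOutput_congr fun s hs => ?_
  have hsN := lt_of_stream hs
  rw [← sum_blockLoad_eq_count hs hsN e, ← sum_blockLoad_eq_count hs hsN e']
  refine Finset.sum_congr rfl fun r hr => h ⟨r, ?_⟩
  rw [← count_stream]
  exact (Nat.le_of_lt_succ (Finset.mem_range.1 hr)).trans_lt (count_lt_count hs hsN)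

-- Block `r` is charged with the probe packet that ends it; what follows the last probe packet is
-- dropped because it does not influence the output.
theorem base_pow_le_prod_blockWeight (e : Fin N → Bool) :
    base ^ (N + weight d + weight e) ≤
      ∏ r : Fin (weight d),
        blockWeight (block (stream d) N r).card (blockLoad (stream d) N (stream e) r) := by
  have hslots : ∑ r ∈ Finset.range (weight d), (block (stream d) N r).card ≤ N := by
    simpa using sum_block_le (d := stream d) (N := N) (R := weight d) fun _ => 1
  have hpackets : ∑ r ∈ Finset.range (weight d), blockLoad (stream d) N (stream e) r ≤ weight e :=
    (sum_block_le _).trans_eq (count_stream e)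
  simp only [blockWeight, Finset.prod_pow_eq_pow_sum]
  refine pow_le_pow_of_le_one base_pos.le base_lt_one.le ?_
  rw [← Finset.sum_range fun r =>
    (block (stream d) N r).card + 1 + blockLoad (stream d) N (stream e) r]
  simp only [Finset.sum_add_distrib, Finset.sum_const, Finset.card_range, smul_eq_mul, mul_one]
  lia

theorem sum_base_pow_le_one {ι : Type*} {S : Finset ι} {c : ι → Fin N → Bool}
    (hS : Set.InjOn (fun w => probeOutput b (stream d) (stream (c w))) S) :
    ∑ w ∈ S, base ^ (N + weight d + weight (c w)) ≤ 1 := by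
  have hinj : Set.InjOn
      (fun w (r : Fin (weight d)) => blockLoad (stream d) N (stream (c w)) r) S :=
    fun w hw w' hw' h => hS hw hw' (probeOutput_eq_of_blockLoad_eq d (congrFun h))
  calc ∑ w ∈ S, base ^ (N + weight d + weight (c w))
      ≤ ∑ w ∈ S, ∏ r : Fin (weight d),
          blockWeight (block (stream d) N r).card (blockLoad (stream d) N (stream (c w)) r) :=
        Finset.sum_le_sum fun w _ => base_pow_le_prod_blockWeight d (c w)
    _ ≤ ∏ r : Fin (weight d), ∑ j ∈ Finset.range ((block (stream d) N r).card + 1),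
          blockWeight (block (stream d) N r).card j :=
        sum_prod_le_prod_sum (fun _ _ => (blockWeight_pos _ _).le)
          (fun w _ r => Finset.mem_range_succ_iff.2 (blockLoad_le_card _ _ _ _)) hinj
    _ ≤ 1 := Finset.prod_le_one
        (fun r _ => Finset.sum_nonneg fun j _ => (blockWeight_pos _ _).le)
        fun r _ => sum_blockWeight_le_one _

end Kraft

/-! ### Converse -/

namespace Code

variable (c : Code) (b : ℕ)

theorem M_cast_pos : (0 : ℝ) < c.M := by exact_mod_cast c.M_pos

theorem N_cast_pos : (0 : ℝ) < c.N := by exact_mod_cast c.N_pos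

section Mean

variable {c} in
theorem mean_mono {f g : (Fin c.N → Bool) → Fin c.M → ℝ} (h : ∀ d w, f d w ≤ g d w) :
    c.mean f ≤ c.mean g := by
  refine Finset.sum_le_sum fun d _ => mul_le_mul_of_nonneg_left ?_ (c.probeLaw_mem.1 d)
  exact mul_le_mul_of_nonneg_left (Finset.sum_le_sum fun w _ => h d w) (by positivity)

theorem mean_add (f g : (Fin c.N → Bool) → Fin c.M → ℝ) :
    c.mean (fun d w => f d w + g d w) = c.mean f + c.mean g := by
  simp only [mean, Finset.sum_add_distrib, mul_add]

theorem mean_const_mul (a : ℝ) (f : (Fin c.N → Bool) → Fin c.M → ℝ) :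
    c.mean (fun d w => a * f d w) = a * c.mean f := by
  simp only [mean, ← Finset.mul_sum, mul_left_comm _ a]

variable {c} in
theorem mean_le_of_sum_le {f : (Fin c.N → Bool) → Fin c.M → ℝ} {a : ℝ}
    (h : ∀ d, ∑ w, f d w ≤ c.M * a) : c.mean f ≤ a := by
  calc c.mean f ≤ ∑ d, c.probeLaw d * a := by
        refine Finset.sum_le_sum fun d _ => mul_le_mul_of_nonneg_left ?_ (c.probeLaw_mem.1 d)
        rw [one_div_mul_eq_div, div_le_iff₀' c.M_cast_pos]
        exact h d
    _ = a := by rw [← Finset.sum_mul, c.probeLaw_mem.2, one_mul]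

theorem mean_const (a : ℝ) : c.mean (fun _ _ => a) = a := by
  have hM := c.M_cast_pos.ne'
  simp only [mean, Finset.sum_const, Finset.card_univ, Fintype.card_fin, nsmul_eq_mul]
  rw [← Finset.sum_mul, c.probeLaw_mem.2]
  field_simp

end Mean

theorem N_le_avgTime : (c.N : ℝ) ≤ c.avgTime b := by
  rw [← c.mean_const c.N]
  exact mean_mono fun d w => by exact_mod_cast le_receptionTime b d _

/-- The total cost of sending message `w` under the probe stream `d`: one unit for each slot and
each packet. -/
def cost (d : Fin c.N → Bool) (w : Fin c.M) : ℕ := c.N + weight d + weight (c.codeword w)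

theorem mean_cost : c.mean (fun d w => c.cost d w) = c.N * (1 + c.encRate + c.probeRate) := by
  have hN := c.N_cast_pos.ne'
  have hcost (d w) : (c.cost d w : ℝ) =
      c.N * (1 + (weight (c.codeword w) : ℝ) / c.N + (weight d : ℝ) / c.N) := by
    rw [cost]; push_cast; field_simp; ring
  simp only [hcost, mean_const_mul, mean_add, mean_const, encRate, probeRate]

open Classical in
/-- The indicator of the event that message `w` is decoded correctly under the probe stream
`d`. -/
def success (d : Fin c.N → Bool) (w : Fin c.M) : ℝ :=
  if c.decode d (probeOutput b (stream d) (stream (c.codeword w))) = w then 1 else 0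

theorem mean_success : c.mean (c.success b) = 1 - c.errorProb b := by
  rw [eq_sub_iff_add_eq, errorProb, ← mean_add]
  refine (congrArg c.mean ?_).trans (c.mean_const 1)
  funext d w
  rw [success]
  split_ifs <;> simp

theorem mean_success_mul_base_pow_le :
    c.mean (fun d w => c.success b d w * (c.M * base ^ c.cost d w)) ≤ 1 := by
  classical
  refine mean_le_of_sum_le fun d => ?_
  let S : Finset (Fin c.M) :=
    {w | c.decode d (probeOutput b (stream d) (stream (c.codeword w))) = w}
  have hS : Set.InjOn (fun w => probeOutput b (stream d) (stream (c.codeword w))) S := by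
    intro w hw w' hw' h
    rw [← (Finset.mem_filter.1 hw).2, ← (Finset.mem_filter.1 hw').2]
    exact congrArg _ h
  calc ∑ w, c.success b d w * (c.M * base ^ c.cost d w)
      = c.M * ∑ w ∈ S, base ^ c.cost d w := by
        rw [Finset.mul_sum, Finset.sum_filter]
        simp only [success, ite_mul, one_mul, zero_mul]
    _ ≤ c.M * 1 :=
        mul_le_mul_of_nonneg_left (sum_base_pow_le_one d hS) c.M_cast_pos.le

theorem success_mul_log_le (d : Fin c.N → Bool) (w : Fin c.M) :
    c.success b d w * Real.log c.M ≤
      price * c.cost d w + c.success b d w * (c.M * base ^ c.cost d w) := by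
  have hcost : 0 ≤ price * c.cost d w := mul_nonneg price_pos.le (Nat.cast_nonneg _)
  rw [success]
  split_ifs
  · have hbase := pow_pos base_pos (c.cost d w)
    have hlog := Real.log_le_sub_one_of_pos (mul_pos c.M_cast_pos hbase)
    rw [Real.log_mul c.M_cast_pos.ne' hbase.ne', log_base_pow] at hlog
    linarith
  · simpa only [zero_mul, add_zero] using hcost

theorem one_sub_errorProb_mul_log_le (hstable : c.encRate + c.probeRate < 1) :
    (1 - c.errorProb b) * Real.log c.M ≤ 2 * price * c.N + 1 := by
  have hrate : price * (c.N * (1 + c.encRate + c.probeRate)) ≤ price * (c.N * 2) :=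
    mul_le_mul_of_nonneg_left
      (mul_le_mul_of_nonneg_left (by linarith) c.N_cast_pos.le) price_pos.le
  calc (1 - c.errorProb b) * Real.log c.M
      = c.mean fun d w => Real.log c.M * c.success b d w := by
        rw [mean_const_mul, mean_success, mul_comm]
    _ ≤ c.mean fun d w =>
          price * c.cost d w + c.success b d w * (c.M * base ^ c.cost d w) :=
        mean_mono fun d w => by
          rw [mul_comm]
          exact c.success_mul_log_le b d w
    _ ≤ price * (c.N * (1 + c.encRate + c.probeRate)) + 1 := by
        rw [mean_add, mean_const_mul, mean_cost]
        exact add_le_add_right (c.mean_success_mul_base_pow_le b) _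
    _ ≤ 2 * price * c.N + 1 := by linarith

variable {c b} in
theorem Is.one_sub_mul_log_le {n ε : ℝ} {M : ℕ} (h : c.Is b n M ε) :
    (1 - ε) * Real.log M ≤ 2 * price * n + 1 := by
  have hlog : 0 ≤ Real.log c.M := Real.log_natCast_nonneg _
  have htime : (c.N : ℝ) ≤ n := h.time ▸ c.N_le_avgTime b
  calc (1 - ε) * Real.log M ≤ (1 - c.errorProb b) * Real.log c.M := by
        rw [← h.size]
        exact mul_le_mul_of_nonneg_right (sub_le_sub_left h.error 1) hlog
    _ ≤ 2 * price * c.N + 1 := c.one_sub_errorProb_mul_log_le b h.stable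
    _ ≤ 2 * price * n + 1 := by
        have := mul_le_mul_of_nonneg_left htime price_pos.le
        linarith

end Code

theorem Achievable.le_capacity {b : ℕ} {R : ℝ} (hR : Achievable b R) : R ≤ capacity := by
  have : 0 < Real.log 2 := Real.log_pos one_lt_two
  refine le_of_forall_pos_sub_le fun δ hδ => ?_
  obtain ⟨n, M, ε, hcode, hrate, hn, hε⟩ := hR δ hδ
  have hlower : Tendsto (fun k => (1 - ε k) * (R - δ)) atTop (𝓝 (R - δ)) := by
    simpa using (tendsto_const_nhds (x := (1 : ℝ))).sub hε |>.mul_const (R - δ)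
  have hupper : Tendsto (fun k => capacity + (Real.log 2)⁻¹ * (n k)⁻¹) atTop (𝓝 capacity) := by
    simpa using (hn.inv_tendsto_atTop.const_mul (Real.log 2)⁻¹).const_add capacity
  refine le_of_tendsto_of_tendsto hlower hupper ?_
  filter_upwards [hn.eventually_gt_atTop 0, hε.eventually_lt_const one_pos] with k hnk hεk
  obtain ⟨c, hc⟩ := hcode k
  calc (1 - ε k) * (R - δ) ≤ (1 - ε k) * (Real.logb 2 (M k) / n k) :=
        mul_le_mul_of_nonneg_left (hrate k).le (by linarith)
    _ = (1 - ε k) * Real.log (M k) / (Real.log 2 * n k) := by rw [Real.logb]; field_simp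
    _ ≤ (2 * price * n k + 1) / (Real.log 2 * n k) :=
        div_le_div_of_nonneg_right hc.one_sub_mul_log_le (by positivity)
    _ = capacity + (Real.log 2)⁻¹ * (n k)⁻¹ := by rw [capacity]; field_simp

/-! ### Gibbs bound for the optimization problem -/

theorem sum_negMulLog_le {ι : Type*} [Fintype ι] {p q : ι → ℝ} (hp : ∀ i, 0 < p i)
    (hq : ∀ i, 0 ≤ q i) (hpq : ∑ i, p i ≤ ∑ i, q i) :
    ∑ i, Real.negMulLog (q i) ≤ ∑ i, -(q i * Real.log (p i)) := by
  have hterm (i : ι) : Real.negMulLog (q i) ≤ -(q i * Real.log (p i)) + (p i - q i) := by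
    rcases (hq i).eq_or_lt with h | h
    · simp [← h, (hp i).le]
    · have hlog := mul_le_mul_of_nonneg_left (Real.log_le_sub_one_of_pos (div_pos (hp i) h)) h.le
      rw [Real.log_div (hp i).ne' h.ne', mul_sub, mul_sub, mul_div_cancel₀ _ h.ne'] at hlog
      rw [Real.negMulLog]
      linarith
  refine (Finset.sum_le_sum fun i _ => hterm i).trans ?_
  rw [Finset.sum_add_distrib, Finset.sum_sub_distrib]
  linarith

section Htilde

variable {γ : ℝ} {k : ℕ}

theorem sum_neg_mul_log_blockWeight {q : Fin (k + 1) → ℝ} (hq : ∑ i, q i = 1)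
    (hmean : ∑ i : Fin (k + 1), ((i : ℕ) : ℝ) * q i = k * γ) :
    ∑ i : Fin (k + 1), -(q i * Real.log (blockWeight k i)) = price * (k + 1 + k * γ) := by
  have hterm (i : Fin (k + 1)) : -(q i * Real.log (blockWeight k i)) =
      price * ((k + 1) * q i + (i : ℕ) * q i) := by rw [log_blockWeight]; ring
  simp only [hterm, ← Finset.mul_sum, Finset.sum_add_distrib, hq, hmean, mul_one]

theorem le_of_mem_entropySet {v : ℝ} (hv : v ∈ entropySet γ k) :
    v ≤ price * (k + 1 + k * γ) / Real.log 2 := by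
  obtain ⟨q, ⟨hq, hmean⟩, rfl⟩ := hv
  rw [← sum_neg_mul_log_blockWeight hq.2 hmean]
  refine div_le_div_of_nonneg_right ?_ (Real.log_pos one_lt_two).le
  refine sum_negMulLog_le (fun i => blockWeight_pos k i) hq.1 ?_
  rw [hq.2, ← Finset.sum_range]
  exact sum_blockWeight_le_one k

theorem mem_entropySet (hsum : ∑ j ∈ Finset.range (k + 1), blockWeight k j = 1)
    (hmean : ∑ j ∈ Finset.range (k + 1), (j : ℝ) * blockWeight k j = k * γ) :
    price * (k + 1 + k * γ) / Real.log 2 ∈ entropySet γ k := by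
  rw [Finset.sum_range] at hsum hmean
  refine ⟨fun i => blockWeight k i, ⟨⟨fun i => (blockWeight_pos k i).le, hsum⟩, hmean⟩, ?_⟩
  rw [← sum_neg_mul_log_blockWeight hsum hmean, entropy]
  simp only [Real.negMulLog, neg_mul]

theorem Htilde_le (hk : 0 < k) (h0 : 0 ≤ γ) (h1 : γ ≤ 1) :
    Htilde γ k ≤ price * (1 + 1 / k + γ) / Real.log 2 := by
  calc Htilde γ k ≤ 1 / (k : ℝ) * (price * (k + 1 + k * γ) / Real.log 2) :=
        mul_le_mul_of_nonneg_left (le_of_mem_entropySet (isGreatest_entropySet h0 h1).1)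
          (by positivity)
    _ = price * (1 + 1 / k + γ) / Real.log 2 := by field_simp

theorem Htilde_eq (hk : 0 < k) (hsum : ∑ j ∈ Finset.range (k + 1), blockWeight k j = 1)
    (hmean : ∑ j ∈ Finset.range (k + 1), (j : ℝ) * blockWeight k j = k * γ) :
    Htilde γ k = price * (1 + 1 / k + γ) / Real.log 2 := by
  have hgreatest : IsGreatest (entropySet γ k) (price * (k + 1 + k * γ) / Real.log 2) :=
    ⟨mem_entropySet hsum hmean, fun _ => le_of_mem_entropySet⟩
  rw [Htilde, hgreatest.csSup_eq]
  field_simp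

end Htilde

theorem objective_le_capacity {α γ₁ γ₂ : ℝ} (h : Feasible α γ₁ γ₂) :
    objective α γ₁ γ₂ ≤ capacity := by
  have hγ₁ := Htilde_le one_pos h.γ₁_mem.1 (h.γ₁_mem.2.trans (by norm_num))
  have hγ₂ := Htilde_le two_pos h.γ₂_mem.1 (h.γ₂_mem.2.trans (by norm_num))
  refine (add_le_add (mul_le_mul_of_nonneg_left hγ₁ h.α_mem.1)
    (mul_le_mul_of_nonneg_left hγ₂ (sub_nonneg.2 h.α_mem.2))).trans_eq ?_
  rw [capacity]
  push_cast
  linear_combination price / Real.log 2 * h.rate_eq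

/-- The optimal encoder rate in blocks of length one: the mean of the law `blockWeight 1`. -/
def optγ₁ : ℝ := blockWeight 1 1

/-- The optimal encoder rate in blocks of length two: half the mean of the law `blockWeight 2`. -/
def optγ₂ : ℝ := (blockWeight 2 1 + 2 * blockWeight 2 2) / 2

/-- The optimal fraction of time for blocks of length one, which makes the total packet rate `1`. -/
def optα : ℝ := (1 / 2 - optγ₂) / (optγ₁ - optγ₂ + 1 / 2)

theorem optγ₁_mem_Icc : optγ₁ ∈ Set.Icc (0.4301 : ℝ) 0.4302 := by
  have hlower : 0.7548776 ^ 3 ≤ base ^ 3 := pow_le_pow_left₀ (by norm_num) lt_base.le 3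
  have hupper : base ^ 3 ≤ 0.7548777 ^ 3 := pow_le_pow_left₀ base_pos.le base_lt.le 3
  simp only [optγ₁, blockWeight, Nat.reduceAdd]
  constructor <;> linarith

theorem optγ₂_mem_Icc : optγ₂ ∈ Set.Icc (0.4074 : ℝ) 0.4075 := by
  have hlower₄ : 0.7548776 ^ 4 ≤ base ^ 4 := pow_le_pow_left₀ (by norm_num) lt_base.le 4
  have hupper₄ : base ^ 4 ≤ 0.7548777 ^ 4 := pow_le_pow_left₀ base_pos.le base_lt.le 4
  have hlower₅ : 0.7548776 ^ 5 ≤ base ^ 5 := pow_le_pow_left₀ (by norm_num) lt_base.le 5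
  have hupper₅ : base ^ 5 ≤ 0.7548777 ^ 5 := pow_le_pow_left₀ base_pos.le base_lt.le 5
  simp only [optγ₂, blockWeight, Nat.reduceAdd]
  constructor <;> linarith

theorem optγ₁_sub_optγ₂_add_pos : 0 < optγ₁ - optγ₂ + 1 / 2 := by
  linarith [optγ₁_mem_Icc.1, optγ₂_mem_Icc.2]

theorem optα_mem_Icc : optα ∈ Set.Icc (0.1765 : ℝ) 0.1775 := by
  obtain ⟨hγ₁, hγ₁'⟩ := optγ₁_mem_Icc
  obtain ⟨hγ₂, hγ₂'⟩ := optγ₂_mem_Icc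
  constructor
  · rw [optα, le_div_iff₀ optγ₁_sub_optγ₂_add_pos]; linarith
  · rw [optα, div_le_iff₀ optγ₁_sub_optγ₂_add_pos]; linarith

theorem feasible_opt : Feasible optα optγ₁ optγ₂ where
  α_mem := Set.Icc_subset_Icc (by norm_num) (by norm_num) optα_mem_Icc
  γ₁_mem := Set.Icc_subset_Icc (by norm_num) (by norm_num) optγ₁_mem_Icc
  γ₂_mem := Set.Icc_subset_Icc (by norm_num) (by norm_num) optγ₂_mem_Icc
  rate_eq := by
    have hα : optα * (optγ₁ - optγ₂ + 1 / 2) = 1 / 2 - optγ₂ :=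
      div_mul_cancel₀ _ optγ₁_sub_optγ₂_add_pos.ne'
    linear_combination hα

theorem objective_opt : objective optα optγ₁ optγ₂ = capacity := by
  have hγ₁ : Htilde optγ₁ 1 = _ :=
    Htilde_eq one_pos sum_blockWeight_one (by simp [Finset.sum_range_succ, optγ₁])
  have hγ₂ : Htilde optγ₂ 2 = _ :=
    Htilde_eq two_pos sum_blockWeight_two (by simp [Finset.sum_range_succ, optγ₂]; ring)
  rw [objective, hγ₁, hγ₂, capacity]
  push_cast
  linear_combination price / Real.log 2 * feasible_opt.rate_eq

/-! ### Load vectors and busy servers -/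

/-- A gap of `g` slots with packets in its first `j` slots. -/
def burst (g j : ℕ) : List Bool := List.replicate j true ++ List.replicate (g - j) false

/-- The binary word whose `r`-th gap has length `gs[r]` and contains `fs[r]` packets. -/
def pulses (gs fs : List ℕ) : List Bool := (List.zipWith burst gs fs).flatten

/-- The probe stream of a list of gaps: one packet at the beginning of each gap. -/
def probes (gs : List ℕ) : List Bool := pulses gs (gs.map fun _ => 1)

/-- The load vectors of a list of gaps: the lists `fs` with `fs[r] ≤ gs[r]`. -/
def loads : List ℕ → Finset (List ℕ)
  | [] => {[]}
  | g :: gs => Finset.image₂ List.cons (Finset.range (g + 1)) (loads gs)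

theorem mem_loads {gs fs : List ℕ} : fs ∈ loads gs ↔ List.Forall₂ (· ≤ ·) fs gs := by
  induction gs generalizing fs with
  | nil => simp [loads]
  | cons g gs ih =>
    cases fs with
    | nil => simp [loads]
    | cons f fs => simp [loads, ih]

theorem length_pulses {gs fs : List ℕ} (h : fs ∈ loads gs) : (pulses gs fs).length = gs.sum := by
  rw [mem_loads] at h
  induction h with
  | nil => rfl
  | cons h _ ih =>
    simp only [pulses, burst, List.zipWith_cons_cons, List.flatten_cons, List.length_append,
      List.length_replicate, List.sum_cons] at ih ⊢
    lia

theorem count_pulses {gs fs : List ℕ} (h : fs ∈ loads gs) : (pulses gs fs).count true = fs.sum := by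
  rw [mem_loads] at h
  induction h with
  | nil => rfl
  | cons _ _ ih =>
    simp only [pulses, burst, List.zipWith_cons_cons, List.flatten_cons, List.count_append,
      List.sum_cons] at ih ⊢
    simp [List.count_replicate, ih]

theorem pulses_append {gs fs : List ℕ} (h : fs ∈ loads gs) (gs' fs' : List ℕ) :
    pulses (gs ++ gs') (fs ++ fs') = pulses gs fs ++ pulses gs' fs' := by
  rw [pulses, List.zipWith_append (mem_loads.1 h).length_eq.symm, List.flatten_append]
  rfl

theorem count_take_pulses {gs fs : List ℕ} (h : fs ∈ loads gs) (r : ℕ) :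
    ((pulses gs fs).take (gs.take r).sum).count true = (fs.take r).sum := by
  have htake : fs.take r ∈ loads (gs.take r) := mem_loads.2 (List.forall₂_take r (mem_loads.1 h))
  have happend := pulses_append htake (gs.drop r) (fs.drop r)
  rw [List.take_append_drop, List.take_append_drop] at happend
  rw [happend, ← length_pulses htake, List.take_left, count_pulses htake]

theorem map_one_mem_loads {gs : List ℕ} (hpos : ∀ g ∈ gs, 0 < g) :
    gs.map (fun _ => 1) ∈ loads gs := by
  rw [mem_loads, List.forall₂_map_left_iff, List.forall₂_same]
  exact hpos

theorem length_probes {gs : List ℕ} (hpos : ∀ g ∈ gs, 0 < g) : (probes gs).length = gs.sum :=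
  length_pulses (map_one_mem_loads hpos)

theorem count_probes {gs : List ℕ} (hpos : ∀ g ∈ gs, 0 < g) :
    (probes gs).count true = gs.length := by
  rw [probes, count_pulses (map_one_mem_loads hpos)]
  simp

theorem probes_append {gs : List ℕ} (hpos : ∀ g ∈ gs, 0 < g) (gs' : List ℕ) :
    probes (gs ++ gs') = probes gs ++ probes gs' := by
  rw [probes, List.map_append, pulses_append (map_one_mem_loads hpos)]
  rfl

theorem getElem?_probes {gs : List ℕ} (hpos : ∀ g ∈ gs, 0 < g) {r : ℕ} (hr : r < gs.length) :
    (probes gs)[(gs.take r).sum]? = some true := by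
  have hpos' : ∀ g ∈ gs.take r, 0 < g := fun g hg => hpos g (List.mem_of_mem_take hg)
  nth_rw 1 [← List.take_append_drop r gs]
  rw [probes_append hpos', List.getElem?_append_right (length_probes hpos').le,
    length_probes hpos', Nat.sub_self, List.drop_eq_getElem_cons hr]
  rfl

/-- The server, with `l` packets in the queue at the beginning, does not run out of packets while
the streams `D` and `E` arrive. -/
def Busy (l : ℕ) (D E : List Bool) : Prop :=
  ∀ t ≤ D.length, t ≤ l + (D.take t).count true + (E.take t).count true

theorem busy_of_length_le {l : ℕ} {D : List Bool} (h : D.length ≤ l) (E : List Bool) :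
    Busy l D E :=
  fun t ht => by lia

theorem Busy.append {l l' : ℕ} {D D' E E' : List Bool} (h : Busy l D E) (h' : Busy l' D' E')
    (hlength : D.length = E.length)
    (hslack : l' + D.length ≤ l + D.count true + E.count true) : Busy l (D ++ D') (E ++ E') := by
  intro t ht
  rcases le_or_gt t D.length with htD | htD
  · rw [List.take_append_of_le_length htD, List.take_append_of_le_length (hlength ▸ htD)]
    exact h t htD
  · obtain ⟨s, rfl⟩ := Nat.exists_eq_add_of_lt htD
    rw [List.length_append] at ht
    have := h' (s + 1) (by lia)
    rw [add_assoc, List.take_length_add_append, hlength, List.take_length_add_append]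
    simp only [List.count_append]
    lia

/-- There are `m` load vectors of total load `w` for the gaps `gs` that keep the server busy if
`l` packets are in the queue at the beginning. -/
def HasCodebook (gs : List ℕ) (w l m : ℕ) : Prop :=
  (∀ g ∈ gs, 0 < g) ∧ ∃ X : Finset (List ℕ), X.card = m ∧
    ∀ fs ∈ X, fs ∈ loads gs ∧ fs.sum = w ∧ Busy l (probes gs) (pulses gs fs)

theorem HasCodebook.of_sum_le {gs : List ℕ} {w l l' m : ℕ} (h : HasCodebook gs w l m)
    (hl' : gs.sum ≤ l') : HasCodebook gs w l' m := by
  obtain ⟨hpos, X, hcard, hX⟩ := h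
  exact ⟨hpos, X, hcard, fun fs hfs => ⟨(hX fs hfs).1, (hX fs hfs).2.1,
    busy_of_length_le ((length_probes hpos).trans_le hl') _⟩⟩

theorem HasCodebook.append {gs gs' : List ℕ} {w w' l l' m m' : ℕ} (h : HasCodebook gs w l m)
    (h' : HasCodebook gs' w' l' m') (hslack : l' + gs.sum ≤ l + gs.length + w) :
    HasCodebook (gs ++ gs') (w + w') l (m * m') := by
  obtain ⟨hpos, X, rfl, hX⟩ := h
  obtain ⟨hpos', Y, rfl, hY⟩ := h'
  refine ⟨fun g hg => (List.mem_append.1 hg).elim (hpos g) (hpos' g),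
    Finset.image₂ (· ++ ·) X Y, Finset.card_image₂_iff.2 ?_, ?_⟩
  · rintro ⟨fs, fs'⟩ hfs ⟨es, es'⟩ hes heq
    have hlength : fs.length = es.length :=
      (mem_loads.1 (hX fs hfs.1).1).length_eq.trans (mem_loads.1 (hX es hes.1).1).length_eq.symm
    exact Prod.ext_iff.2 (List.append_inj heq hlength)
  · intro es hes
    obtain ⟨fs, hfs, fs', hfs', rfl⟩ := Finset.mem_image₂.1 hes
    obtain ⟨hload, hsum, hbusy⟩ := hX fs hfs
    obtain ⟨hload', hsum', hbusy'⟩ := hY fs' hfs'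
    refine ⟨mem_loads.2 (List.rel_append (mem_loads.1 hload) (mem_loads.1 hload')),
      by rw [List.sum_append, hsum, hsum'], ?_⟩
    rw [probes_append hpos, pulses_append hload]
    refine hbusy.append hbusy' ?_ ?_
    · rw [length_probes hpos, length_pulses hload]
    · rwa [length_probes hpos, count_probes hpos, count_pulses hload, hsum]

theorem hasCodebook_nil (l : ℕ) : HasCodebook [] 0 l 1 :=
  ⟨by simp, {[]}, Finset.card_singleton _,
    by simpa [loads] using busy_of_length_le (Nat.zero_le l) (pulses [] [])⟩

theorem HasCodebook.replicate {gs : List ℕ} {w l m : ℕ} (h : HasCodebook gs w l m)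
    (hdrift : gs.sum ≤ gs.length + w) (K : ℕ) :
    HasCodebook (List.replicate K gs).flatten (K * w) l (m ^ K) := by
  induction K with
  | zero => simpa using hasCodebook_nil l
  | succ K ih =>
    rw [List.replicate_succ, List.flatten_cons, pow_succ', Nat.succ_mul, add_comm]
    exact h.append ih (by lia)

theorem hasCodebook_one : HasCodebook [1] 1 0 1 := by
  refine ⟨by simp, {[1]}, Finset.card_singleton _, ?_⟩
  simp only [Finset.mem_singleton, forall_eq]
  exact ⟨by decide, rfl, by unfold Busy; decide⟩

/-! ### Counting load vectors -/

section Counting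

variable {gs fs : List ℕ}

theorem sum_loads_base_pow (h : ∀ g ∈ gs, ∑ j ∈ Finset.range (g + 1), blockWeight g j = 1) :
    ∑ fs ∈ loads gs, base ^ (gs.sum + gs.length + fs.sum) = 1 := by
  induction gs with
  | nil => simp [loads]
  | cons g gs ih =>
    rw [List.forall_mem_cons] at h
    rw [loads, Finset.image₂, Finset.sum_image (by simp), Finset.sum_product]
    calc ∑ j ∈ Finset.range (g + 1), ∑ fs ∈ loads gs,
          base ^ ((g :: gs).sum + (g :: gs).length + (j :: fs).sum)
        = ∑ j ∈ Finset.range (g + 1), ∑ fs ∈ loads gs,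
            blockWeight g j * base ^ (gs.sum + gs.length + fs.sum) := by
          refine Finset.sum_congr rfl fun j _ => Finset.sum_congr rfl fun fs _ => ?_
          rw [blockWeight, List.sum_cons, List.length_cons, List.sum_cons]
          ring
      _ = 1 := by rw [← Finset.sum_mul_sum, h.1, ih h.2, mul_one]

/-- The load vectors of total load `s`. -/
def loadsOfSum (gs : List ℕ) (s : ℕ) : Finset (List ℕ) := {fs ∈ loads gs | fs.sum = s}

theorem sum_le_of_mem_loads (h : fs ∈ loads gs) : fs.sum ≤ gs.sum :=
  List.Forall₂.sum_le_sum (mem_loads.1 h)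

theorem zipWith_sub_mem_loads (h : fs ∈ loads gs) : List.zipWith (· - ·) gs fs ∈ loads gs := by
  rw [mem_loads] at *
  induction h with
  | nil => exact .nil
  | cons _ _ ih => exact .cons (Nat.sub_le _ _) ih

theorem sum_zipWith_sub (h : fs ∈ loads gs) :
    (List.zipWith (· - ·) gs fs).sum = gs.sum - fs.sum := by
  rw [mem_loads] at h
  induction h with
  | nil => rfl
  | cons h hs ih =>
    have := sum_le_of_mem_loads (mem_loads.2 hs)
    simp only [List.zipWith_cons_cons, List.sum_cons, ih]
    lia

theorem zipWith_sub_zipWith_sub (h : fs ∈ loads gs) :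
    List.zipWith (· - ·) gs (List.zipWith (· - ·) gs fs) = fs := by
  rw [mem_loads] at h
  induction h with
  | nil => rfl
  | cons h _ ih => rw [List.zipWith_cons_cons, List.zipWith_cons_cons, ih, Nat.sub_sub_self h]

theorem card_loadsOfSum_le (gs : List ℕ) (s : ℕ) :
    (loadsOfSum gs s).card ≤ (loadsOfSum gs (gs.sum - s)).card := by
  refine Finset.card_le_card_of_injOn (List.zipWith (· - ·) gs) (fun fs hfs => ?_)
    fun fs hfs es hes heq => ?_
  · obtain ⟨hload, rfl⟩ := Finset.mem_filter.1 hfs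
    exact Finset.mem_filter.2 ⟨zipWith_sub_mem_loads hload, sum_zipWith_sub hload⟩
  · rw [← zipWith_sub_zipWith_sub (Finset.mem_filter.1 hfs).1, heq,
      zipWith_sub_zipWith_sub (Finset.mem_filter.1 hes).1]

theorem exists_one_le_card_loadsOfSum
    (h : ∀ g ∈ gs, ∑ j ∈ Finset.range (g + 1), blockWeight g j = 1) :
    ∃ s, 2 * s ≤ gs.sum ∧
      1 ≤ (gs.sum + 1) * ((loadsOfSum gs s).card * base ^ (gs.sum + gs.length + s)) := by
  set mass : ℕ → ℝ := fun s => (loadsOfSum gs s).card * base ^ (gs.sum + gs.length + s)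
  have hsum : ∑ s ∈ Finset.range (gs.sum + 1), mass s = 1 := by
    rw [← sum_loads_base_pow h, ← Finset.sum_fiberwise_of_maps_to (g := List.sum)
      fun fs hfs => Finset.mem_range_succ_iff.2 (sum_le_of_mem_loads hfs)]
    refine Finset.sum_congr rfl fun s _ => ?_
    rw [Finset.sum_congr rfl fun fs hfs => by rw [(Finset.mem_filter.1 hfs).2],
      Finset.sum_const, nsmul_eq_mul]
    rfl
  obtain ⟨s, hs, hle⟩ : ∃ s ∈ Finset.range (gs.sum + 1), 1 / ((gs.sum : ℝ) + 1) ≤ mass s := by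
    refine Finset.exists_le_of_sum_le ⟨0, by simp⟩ ?_
    rw [hsum, Finset.sum_const, Finset.card_range, nsmul_eq_mul, Nat.cast_add_one,
      mul_one_div_cancel (by positivity)]
  rw [div_le_iff₀' (by positivity)] at hle
  rcases le_or_gt (2 * s) gs.sum with hs2 | hs2
  · exact ⟨s, hs2, hle⟩
  -- Complementing the loads lowers the total load, hence increases the mass.
  · have hs' := Finset.mem_range_succ_iff.1 hs
    refine ⟨gs.sum - s, by lia, hle.trans (mul_le_mul_of_nonneg_left ?_ (by positivity))⟩
    exact mul_le_mul (by exact_mod_cast card_loadsOfSum_le gs s)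
      (pow_le_pow_of_le_one base_pos.le base_lt_one.le (by lia)) (pow_pos base_pos _).le
      (Nat.cast_nonneg _)

end Counting

/-- There are load vectors of total load `w` for the gaps `gs`, usable once the queue holds
`gs.sum` packets, whose number is, up to a loss of `η` nats per slot, the best that the total number
of slots and packets permits. -/
def IsEfficient (η : ℝ) (gs : List ℕ) (w : ℕ) : Prop :=
  ∃ m : ℕ, 0 < m ∧ HasCodebook gs w gs.sum m ∧
    price * (gs.sum + gs.length + w) - η * gs.sum ≤ Real.log m

theorem isEfficient_nil (η : ℝ) : IsEfficient η [] 0 :=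
  ⟨1, one_pos, hasCodebook_nil 0, by simp⟩

theorem IsEfficient.append {η : ℝ} {gs gs' : List ℕ} {w w' : ℕ} (h : IsEfficient η gs w)
    (h' : IsEfficient η gs' w') : IsEfficient η (gs ++ gs') (w + w') := by
  obtain ⟨m, hm, hcode, hlog⟩ := h
  obtain ⟨m', hm', hcode', hlog'⟩ := h'
  refine ⟨m * m', mul_pos hm hm',
    (hcode.of_sum_le (by simp)).append hcode' (by rw [List.sum_append]; lia), ?_⟩
  rw [Nat.cast_mul, Real.log_mul (by positivity) (by positivity), List.sum_append,
    List.length_append]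
  simp only [Nat.cast_add]
  linarith

theorem IsEfficient.replicate {η : ℝ} {gs : List ℕ} {w : ℕ} (h : IsEfficient η gs w) (r : ℕ) :
    IsEfficient η (List.replicate r gs).flatten (r * w) := by
  induction r with
  | zero => simpa using isEfficient_nil η
  | succ r ih =>
    rw [List.replicate_succ, List.flatten_cons, Nat.succ_mul, add_comm]
    exact h.append ih

theorem hasCodebook_loadsOfSum {gs : List ℕ} (hpos : ∀ g ∈ gs, 0 < g) (s : ℕ) :
    HasCodebook gs s gs.sum (loadsOfSum gs s).card := by
  refine ⟨hpos, loadsOfSum gs s, rfl, fun fs hfs => ?_⟩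
  obtain ⟨hload, hsum⟩ := Finset.mem_filter.1 hfs
  exact ⟨hload, hsum, busy_of_length_le (length_probes hpos).le _⟩

theorem exists_isEfficient_replicate {k : ℕ} (hk : 0 < k)
    (hsum : ∑ j ∈ Finset.range (k + 1), blockWeight k j = 1) {η : ℝ} (hη : 0 < η) :
    ∃ A s, 0 < A ∧ 2 * s ≤ k * A ∧ IsEfficient η (List.replicate A k) s := by
  have hlog_add_one : ∀ᶠ n : ℕ in atTop, Real.log (n + 1) ≤ η * n := by
    have hlittle := Real.isLittleO_log_id_atTop.bound (half_pos hη)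
    filter_upwards [(tendsto_atTop_add_const_right atTop (1 : ℝ)
      tendsto_natCast_atTop_atTop).eventually hlittle, eventually_ge_atTop 1] with n hn hn1
    have hn1' : (1 : ℝ) ≤ n := by exact_mod_cast hn1
    have hn' := (Real.le_norm_self _).trans hn
    rw [id, Real.norm_of_nonneg (by linarith)] at hn'
    nlinarith
  obtain ⟨A, hA, hApos⟩ := ((tendsto_id.const_mul_atTop' hk).eventually hlog_add_one).and
    (eventually_gt_atTop 0) |>.exists
  have hk_of_mem {g : ℕ} (hg : g ∈ List.replicate A k) : g = k := List.eq_of_mem_replicate hg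
  obtain ⟨s, hs, hcard⟩ := exists_one_le_card_loadsOfSum (gs := List.replicate A k)
    fun g hg => hk_of_mem hg ▸ hsum
  rw [List.sum_replicate, smul_eq_mul, mul_comm A k] at hs
  have hcard_pos : 0 < (loadsOfSum (List.replicate A k) s).card := by
    by_contra! h0
    rw [Nat.le_zero.1 h0] at hcard
    norm_num at hcard
  refine ⟨A, s, hApos, hs, _, hcard_pos,
    hasCodebook_loadsOfSum (fun g hg => hk_of_mem hg ▸ hk) s, ?_⟩
  have hlog := Real.log_nonneg hcard
  rw [Real.log_mul (by positivity) (by have := base_pos; positivity),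
    Real.log_mul (by positivity) (pow_pos base_pos _).ne', log_base_pow] at hlog
  simp only [List.sum_replicate, smul_eq_mul, mul_comm A k, id] at hlog hA ⊢
  push_cast at hlog hA ⊢
  linarith

/-! ### Achievability -/

theorem exists_isEfficient_balanced {η : ℝ} (hη : 0 < η) :
    ∃ gs w, 0 < gs.sum ∧ gs.sum = gs.length + w ∧ IsEfficient η gs w := by
  obtain ⟨A₁, s₁, hA₁, -, h₁⟩ := exists_isEfficient_replicate one_pos sum_blockWeight_one hη
  obtain ⟨A₂, s₂, hA₂, hs₂, h₂⟩ := exists_isEfficient_replicate two_pos sum_blockWeight_two hη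
  rcases Nat.eq_zero_or_pos s₁ with rfl | hs₁
  · exact ⟨_, 0, by simpa using hA₁, by simp, h₁⟩
  -- The queue grows by `s₁` in the gaps of length one and shrinks by `A₂ - s₂` in those of length
  -- two; the multiplicities make the total drift vanish.
  · obtain ⟨q, rfl⟩ := Nat.exists_eq_add_of_le (show s₂ ≤ A₂ by lia)
    refine ⟨_, _, ?_, ?_, (h₁.replicate q).append (h₂.replicate s₁)⟩
    · simp only [List.sum_append, List.sum_flatten, List.map_replicate, List.sum_replicate,
        smul_eq_mul]
      positivity
    · simp only [List.sum_append, List.sum_flatten, List.map_replicate, List.sum_replicate,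
        List.length_append, List.length_flatten, List.length_replicate, smul_eq_mul]
      ring

section Word

/-- A list of bits as a binary word of length `N`, cut off or continued by idle slots. -/
def word (N : ℕ) (D : List Bool) (i : Fin N) : Bool := D.getD i false

variable {N : ℕ} {D : List Bool}

theorem stream_word (hD : D.length ≤ N) (t : ℕ) : stream (word N D) t = D.getD t false := by
  rcases lt_or_ge t N with ht | ht
  · rw [stream_of_lt _ ht, word]
  · rw [List.getD_eq_default _ _ (hD.trans ht), stream, dif_neg ht.not_gt]

theorem count_stream_word (hD : D.length ≤ N) (t : ℕ) :
    count (stream (word N D)) t = (D.take t).count true := by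
  induction t with
  | zero => simp [count]
  | succ t ih =>
    rw [count_succ, ih, stream_word hD, List.take_add_one, List.count_append,
      List.getD_eq_getElem?_getD]
    rcases D[t]? with _ | _ | _ <;> rfl

theorem stream_word_eq_true_iff (hD : D.length ≤ N) {t : ℕ} :
    stream (word N D) t = true ↔ D[t]? = some true := by
  rw [stream_word hD, List.getD_eq_getElem?_getD]
  rcases D[t]? with _ | _ | _ <;> simp

theorem weight_word (hD : D.length ≤ N) : weight (word N D) = D.count true := by
  rw [← count_stream, count_stream_word hD, List.take_of_length_le hD]

theorem Busy.departure_word {b l : ℕ} {E : List Bool} (h : Busy l D E) (hl : l ≤ b)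
    (hD : D.length ≤ N) (hE : E.length ≤ N) {t : ℕ} (ht : t ≤ D.length) :
    departure b (stream (word N D)) (stream (word N E)) t =
      b + (D.take t).count true + (E.take t).count true := by
  rw [← count_stream_word hD, ← count_stream_word hE]
  refine departure_eq_of_busy fun s hs => ?_
  have := h s (hs.trans ht)
  rw [count_stream_word hD, count_stream_word hE]
  lia

theorem Busy.receptionTime_word {b l : ℕ} {E : List Bool} (h : Busy l D E) (hl : l ≤ b)
    (hD : D.length ≤ N) (hE : E.length ≤ N) (hN : b + D.count true + E.count true < N) :
    receptionTime b (word N D) (word N E) = N := by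
  refine le_antisymm (Nat.sInf_le ⟨le_rfl, fun t ht => ?_⟩) (le_receptionTime b _ _)
  by_contra hout
  obtain ⟨s, hs, rfl⟩ := (probeOutput_eq_true_iff _ _ _ _).1 (Bool.eq_true_of_not_eq_false hout)
  obtain ⟨hsD, -⟩ := List.getElem?_eq_some_iff.1 ((stream_word_eq_true_iff hD).1 hs)
  rw [h.departure_word hl hD hE hsD.le] at ht
  have := (List.take_sublist s D).count_le true
  have := (List.take_sublist s E).count_le true
  lia

end Word

section DeterministicCode

/-- The code with codewords `x` and the fixed probe stream `d` that decodes by inverting the map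
from messages to outputs. -/
def Code.ofProbe (b : ℕ) {N m : ℕ} (hN : 0 < N) (hm : 0 < m) (d : Fin N → Bool)
    (x : Fin m → Fin N → Bool) : Code where
  N := N
  N_pos := hN
  M := m
  M_pos := hm
  codeword := x
  probeLaw := Pi.single d 1
  probeLaw_mem := single_mem_stdSimplex ℝ d
  decode _ :=
    haveI : Nonempty (Fin m) := ⟨⟨0, hm⟩⟩
    Function.invFun fun w => probeOutput b (stream d) (stream (x w))

variable {b N m : ℕ} {hN : 0 < N} {hm : 0 < m} {d : Fin N → Bool} {x : Fin m → Fin N → Bool}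

theorem Code.mean_ofProbe_eq {f : (Fin N → Bool) → Fin m → ℝ} {a : ℝ} (h : ∀ w, f d w = a) :
    (Code.ofProbe b hN hm d x).mean f = a := by
  have hm' : (m : ℝ) ≠ 0 := Nat.cast_ne_zero.2 hm.ne'
  change ∑ d', (Pi.single d 1 : (Fin N → Bool) → ℝ) d' * (1 / (m : ℝ) * ∑ w, f d' w) = a
  simp [Pi.single_apply, h, hm']

theorem Code.is_ofProbe {v : ℕ}
    (hinj : Function.Injective fun w => probeOutput b (stream d) (stream (x w)))
    (htime : ∀ w, receptionTime b d (x w) = N) (hweight : ∀ w, weight (x w) = v)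
    (hstable : weight d + v < N) : (Code.ofProbe b hN hm d x).Is b N m 0 where
  size := rfl
  time := mean_ofProbe_eq fun w => by exact_mod_cast htime w
  error := by
    have : Nonempty (Fin m) := ⟨⟨0, hm⟩⟩
    exact (mean_ofProbe_eq fun w => if_pos (Function.leftInverse_invFun hinj w)).le
  stable := by
    have hencRate : (ofProbe b hN hm d x).encRate = v / N :=
      mean_ofProbe_eq fun w => congrArg (fun k : ℕ => (k : ℝ) / N) (hweight w)
    have hprobeRate : (ofProbe b hN hm d x).probeRate = weight d / N :=
      mean_ofProbe_eq fun _ => rfl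
    have hN' : (0 : ℝ) < N := Nat.cast_pos.2 hN
    rw [hencRate, hprobeRate, ← add_div, div_lt_one hN', add_comm]
    exact_mod_cast hstable

end DeterministicCode

theorem eq_of_count_take_pulses_eq {gs fs fs' : List ℕ} (hpos : ∀ g ∈ gs, 0 < g)
    (hfs : fs ∈ loads gs) (hfs' : fs' ∈ loads gs) (hsum : fs.sum = fs'.sum)
    (h : ∀ s, (probes gs)[s]? = some true →
      ((pulses gs fs).take s).count true = ((pulses gs fs').take s).count true) : fs = fs' := by
  have hlength := (mem_loads.1 hfs).length_eq
  have hlength' := (mem_loads.1 hfs').length_eq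
  refine List.eq_of_sum_take_eq (hlength.trans hlength'.symm) fun r hr => ?_
  rcases hr.lt_or_eq with hr | rfl
  · rw [← count_take_pulses hfs, ← count_take_pulses hfs',
      h _ (getElem?_probes hpos (hlength ▸ hr))]
  · rw [List.take_length, List.take_of_length_le (hlength'.trans hlength.symm).le, hsum]

theorem HasCodebook.sum_le {gs : List ℕ} {w l m : ℕ} (h : HasCodebook gs w l m) (hm : 0 < m) :
    gs.sum ≤ l + gs.length + w := by
  obtain ⟨hpos, X, rfl, hX⟩ := h
  obtain ⟨fs, hfs⟩ := Finset.card_pos.1 hm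
  obtain ⟨hload, hsum, hbusy⟩ := hX fs hfs
  have := hbusy gs.sum (length_probes hpos).ge
  rwa [List.take_of_length_le (length_probes hpos).le, count_probes hpos,
    List.take_of_length_le (length_pulses hload).le, count_pulses hload, hsum] at this

theorem HasCodebook.exists_is {gs : List ℕ} {w l m b N : ℕ} (h : HasCodebook gs w l m)
    (hm : 0 < m) (hl : l ≤ b) (hN : b + gs.length + w < N) : ∃ c : Code, c.Is b N m 0 := by
  have hsumN : gs.sum ≤ N := (h.sum_le hm).trans (by lia)
  obtain ⟨hpos, X, rfl, hX⟩ := h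
  have hD : (probes gs).length ≤ N := (length_probes hpos).trans_le hsumN
  have hE (fs : X) : (pulses gs fs).length ≤ N := (length_pulses (hX fs fs.2).1).trans_le hsumN
  have hbusy (fs : X) : Busy l (probes gs) (pulses gs fs) := (hX fs fs.2).2.2
  have hcount (fs : X) : (pulses gs fs).count true = w :=
    (count_pulses (hX fs fs.2).1).trans (hX fs fs.2).2.1
  have hinj : Function.Injective fun fs : X =>
      probeOutput b (stream (word N (probes gs))) (stream (word N (pulses gs fs))) := by
    intro fs fs' heq
    refine Subtype.ext (eq_of_count_take_pulses_eq hpos (hX fs fs.2).1 (hX fs' fs'.2).1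
      ((hX fs fs.2).2.1.trans (hX fs' fs'.2).2.1.symm) fun s hs => ?_)
    obtain ⟨hsD, -⟩ := List.getElem?_eq_some_iff.1 hs
    have hdeparture := probeOutput_eq_iff.1 heq s ((stream_word_eq_true_iff hD).2 hs)
    rw [(hbusy fs).departure_word hl hD (hE fs) hsD.le,
      (hbusy fs').departure_word hl hD (hE fs') hsD.le] at hdeparture
    lia
  refine ⟨_, Code.is_ofProbe (hN := by lia) (hm := hm) (d := word N (probes gs))
    (x := fun j => word N (pulses gs (X.equivFin.symm j))) (v := w)
    (hinj.comp X.equivFin.symm.injective) (fun j => ?_) (fun j => ?_) ?_⟩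
  · refine (hbusy _).receptionTime_word hl hD (hE _) ?_
    rwa [count_probes hpos, hcount]
  · rw [weight_word (hE _), hcount]
  · rw [weight_word hD, count_probes hpos]
    lia

theorem HasCodebook.exists_is_replicate {gs : List ℕ} {w m : ℕ} (h : HasCodebook gs w gs.sum m)
    (hm : 0 < m) (hbalanced : gs.sum = gs.length + w) (b K : ℕ) :
    ∃ c : Code, c.Is b ↑(K * gs.sum + (b + 2 * gs.sum + 1)) (m ^ K) 0 := by
  -- A prelude of `gs.sum` gaps of length one, all loaded, fills the queue with `gs.sum` packets.
  have hprelude := (hasCodebook_one.replicate (by simp) gs.sum).append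
    (h.replicate hbalanced.le K) (by simp)
  rw [one_pow, one_mul] at hprelude
  refine hprelude.exists_is (pow_pos hm K) (Nat.zero_le b) ?_
  simp only [List.length_append, List.length_flatten, List.map_replicate, List.sum_replicate,
    smul_eq_mul, hbalanced, List.length_singleton]
  lia

theorem achievable_capacity (b : ℕ) : Achievable b capacity := by
  intro δ hδ
  have hlog2 : 0 < Real.log 2 := Real.log_pos one_lt_two
  obtain ⟨gs, w, hL, hbalanced, m, hm, hcode, hlog⟩ :=
    exists_isEfficient_balanced (half_pos (mul_pos hδ hlog2))
  set L := gs.sum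
  set ρ : ℝ := (capacity - δ) * Real.log 2 with hρ
  have hsurplus : 0 < Real.log m - ρ * L := by
    have hcapacity : capacity * Real.log 2 = 2 * price := div_mul_cancel₀ _ hlog2.ne'
    have hbalanced' : (L : ℝ) = gs.length + w := by exact_mod_cast hbalanced
    have hmargin : 0 < δ * Real.log 2 * L := by positivity
    rw [add_assoc, ← hbalanced'] at hlog
    rw [hρ, sub_mul, hcapacity]
    linarith
  obtain ⟨K₀, hK₀⟩ := eventually_atTop.1 ((tendsto_natCast_atTop_atTop.atTop_mul_const
    hsurplus).eventually_gt_atTop (ρ * (b + 2 * L + 1 : ℕ)))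
  refine ⟨fun k => ↑((K₀ + k) * L + (b + 2 * L + 1)), fun k => m ^ (K₀ + k), fun _ => 0,
    fun k => hcode.exists_is_replicate hm hbalanced b (K₀ + k), fun k => ?_, ?_,
    tendsto_const_nhds⟩
  · have hk := hK₀ (K₀ + k) (Nat.le_add_right _ _)
    rw [lt_div_iff₀ (by positivity), Real.logb, lt_div_iff₀ hlog2, Nat.cast_pow, Real.log_pow]
    push_cast at hk ⊢
    linarith
  · refine tendsto_natCast_atTop_atTop.comp (tendsto_atTop_mono (fun k => ?_) tendsto_id)
    exact (Nat.le_add_left k K₀).trans ((Nat.le_mul_of_pos_right _ hL).trans (Nat.le_add_right _ _))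

theorem isCapacity_capacity (b : ℕ) : IsCapacity b capacity :=
  IsGreatest.isLUB ⟨achievable_capacity b, fun _ hR => hR.le_capacity⟩

end CovertQueue

end

theorem theorem1 :
    ∃ C : ℝ,
      -- `C` is the capacity, whatever number `b` of packets is buffered at time zero
      (∀ b : ℕ, CovertQueue.IsCapacity b C) ∧
      -- it is the maximum of the optimization problem
      IsGreatest {v : ℝ | ∃ α γ₁ γ₂ : ℝ, CovertQueue.Feasible α γ₁ γ₂ ∧
        v = CovertQueue.objective α γ₁ γ₂} C ∧
      -- numerical values, to the digits given
      |C - 0.8114| ≤ 0.00005 ∧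
      ∃ α γ₁ γ₂ : ℝ, CovertQueue.Feasible α γ₁ γ₂ ∧ CovertQueue.objective α γ₁ γ₂ = C ∧
        |α - 0.177| ≤ 0.0005 ∧ |γ₁ - 0.43| ≤ 0.005 ∧ |γ₂ - 0.407| ≤ 0.0005 := by
  obtain ⟨hα, hα'⟩ := CovertQueue.optα_mem_Icc
  obtain ⟨hγ₁, hγ₁'⟩ := CovertQueue.optγ₁_mem_Icc
  obtain ⟨hγ₂, hγ₂'⟩ := CovertQueue.optγ₂_mem_Icc
  refine ⟨CovertQueue.capacity, CovertQueue.isCapacity_capacity, ⟨?_, ?_⟩,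
    CovertQueue.abs_capacity_sub_le, CovertQueue.optα, CovertQueue.optγ₁, CovertQueue.optγ₂,
    CovertQueue.feasible_opt, CovertQueue.objective_opt, ?_, ?_, ?_⟩
  · exact ⟨_, _, _, CovertQueue.feasible_opt, CovertQueue.objective_opt.symm⟩
  · rintro _ ⟨α, γ₁, γ₂, h, rfl⟩
    exact CovertQueue.objective_le_capacity h
  all_goals rw [abs_le]; constructor <;> linarith
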